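/- Let $\mathcal Y$ be a separable real Banach space, $\mathcal X=\mathcal Y^*$ its dual, $\mathcal H$ a real Hilbert space, $A:\mathcal X\to\mathcal H$ bounded and linear, and let $J:\mathcal X\to[0,\infty]$ be proper, convex, weak$^*$ lower semicontinuous and absolutely one-homogeneous ($J(cu)=|c|J(u)$ for all $c\in\mathbb R$, with $0\cdot\infty=0$). Put $\mathcal N(J)=\{u: J(u)=0\}$ and $\mathrm{dom}(J)=\{u:J(u)<\infty\}$. Assume: (1) on $\mathcal N(J)$, $u\mapsto\|Au\|_{\mathcal H}$ is a norm equivalent to $\|\cdot\|_{\mathcal X}$ (so that $\mathcal P^A(g):=\mathrm{argmin}_{u\in\mathcal N(J)}\|Au-g\|_{\mathcal H}$ is well defined for $g\in\mathcal H$); (2) there is $C>0$ with $\|u-\mathcal P^A(Au)\|_{\mathcal X}\le C\,J(u)$ for all $u\in\mathcal X$; (3) if $u_k\to u$ weakly$^*$ in $\mathcal X$, then $Au_k\to Au$ weakly in $\mathcal H$. Let $f\in\mathcal H$ be such that no $u\in\mathcal N(J)$ satisfies $Au=f$, and for $t>0$ let $E_t(u)=\|Au-f\|_{\mathcal H}+tJ(u)$.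 Let $\partial J(u)=\{p\in\mathcal X^*: J(u)+\langle p,v-u\rangle\le J(v)\ \forall v\in\mathcal X\}$, and let $A^*:\mathcal H\to\mathcal X^*$ be given by $\langle A^*q,v\rangle=\langle q,Av\rangle_{\mathcal H}$. Let $Q$ be the set of all $q\in\mathcal H$ such that $A^*q\in\partial J(u^\dagger)$ for some $u^\dagger\in\mathrm{dom}(J)$ with $Au^\dagger=f$. Set $t_*=1/\inf_{q\in Q}\|q\|_{\mathcal H}$ if $Q\ne\emptyset$ and $t_*=0$ otherwise, and $$t_{**}=\frac{\sup\{\langle f,Au\rangle_{\mathcal H}: J(u)=1,\ \langle Au,Av\rangle_{\mathcal H}=0\ \forall v\in\mathcal N(J)\}}{\|f-A\mathcal P^A(f)\|_{\mathcal H}}$$ (the supremum of the empty set being $0$; the denominator is nonzero by the assumption on $f$). Then for every $t>0$ the functional $E_t$ has a minimizer, and for almost every $t>0$ the element $Au_t$ is the same for all minimizers $u_t$ of $E_t$. Moreover, for every choice of minimizers $u_t$ of $E_t$, $t>0$ (and with an arbitrary value assigned at $t=0$), the forward solution path $t\mapsto Au_t$ (a) has finite total variation on $(\delta,\infty)$ for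 every $\delta>0$; (b) has finite total variation on $[0,\infty)$ if $t_*>0$; (c) has the following property: for every $a>0$, and also for $a=0$ if $t_*>0$, let $\mu$ be the $\mathcal H$-valued derivative measure of the path on $(a,\infty)$, i.e. the vector measure on $(a,\infty)$ which gives to every compact interval $[b,c]\subset(a,\infty)$ the mass $Au_{c+}-Au_{b-}$ (difference of one-sided limits). Then the jump part of $\mu$, i.e. its restriction to the countable set of its atoms $\{t:\mu(\{t\})\neq0\}$, is supported in $[t_*,t_{**}]$: it vanishes on every Borel set disjoint from $[t_*,t_{**}]$. -/

import Mathlib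

open Set Filter Topology MeasureTheory
open scoped ENNReal NNReal

namespace OneHomReg

section Functional

variable {X H : Type*} [NormedAddCommGroup X] [NormedSpace ℝ X]
  [NormedAddCommGroup H] [InnerProductSpace ℝ H]

/-- Absolute one-homogeneity, `J (c u) = |c| J u` for all real `c`
(with `0 * ∞ = 0`, so that `J 0 = 0`). -/
def AbsOneHomogeneous (J : X → ℝ≥0∞) : Prop :=
  ∀ (c : ℝ) (u : X), J (c • u) = ENNReal.ofReal |c| * J u

/-- The null-space `{u | J u = 0}` of `J`. -/
def nullSpace (J : X → ℝ≥0∞) : Set X := {u | J u = 0}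

/-- The effective domain `{u | J u < ∞}` of `J`. -/
def effDomain (J : X → ℝ≥0∞) : Set X := {u | J u < ⊤}

/-- The energy `‖A u - f‖ + t J u` (both exponents equal to one). -/
noncomputable def energy (A : X →L[ℝ] H) (J : X → ℝ≥0∞) (f : H) (t : ℝ) (u : X) : ℝ≥0∞ :=
  ENNReal.ofReal ‖A u - f‖ + ENNReal.ofReal t * J u

/-- `u` minimizes the energy with parameter `t` over the whole space. -/
def IsMinimizer (A : X →L[ℝ] H) (J : X → ℝ≥0∞) (f : H) (t : ℝ) (u : X) : Prop :=
  ∀ v : X, energy A J f t u ≤ energy A J f t v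

/-- The set `{A u | u minimizes the energy with parameter t}`, i.e. the (set-valued) forward
solution path at time `t`. -/
def forwardSolutions (A : X →L[ℝ] H) (J : X → ℝ≥0∞) (f : H) (t : ℝ) : Set H :=
  {h | ∃ u, IsMinimizer A J f t u ∧ A u = h}

/-- `w` is a best approximation of `g` in the null-space of `J`:
`w ∈ argmin {‖A v - g‖ | J v = 0}`. -/
def IsAProj (A : X →L[ℝ] H) (J : X → ℝ≥0∞) (g : H) (w : X) : Prop :=
  w ∈ nullSpace J ∧ ∀ v ∈ nullSpace J, ‖A w - g‖ ≤ ‖A v - g‖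

/-- The `A`-orthogonal projection of `g` onto the null-space of `J`: the element of
`argmin {‖A v - g‖ | J v = 0}`. It exists and is unique as soon as the null-space is a closed
subspace on which `‖A ·‖` is equivalent to the norm, and `H` is complete. -/
noncomputable def aProj (A : X →L[ℝ] H) (J : X → ℝ≥0∞) (g : H) : X :=
  Classical.epsilon (IsAProj A J g)

/-- The `A`-orthogonal complement `{v | ⟪A v, A u⟫ = 0 for all u ∈ U}`. -/
def aOrth (A : X →L[ℝ] H) (U : Set X) : Set X :=
  {v | ∀ u ∈ U, inner ℝ (A v) (A u) = 0}

/-- The adjoint `A* : H → X*`, `⟨A* q, v⟩ = ⟪q, A v⟫`. -/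
noncomputable def adj (A : X →L[ℝ] H) (q : H) : StrongDual ℝ X :=
  (innerSL ℝ q).comp A

/-- The subdifferential `{p ∈ X* | J u + ⟨p, v - u⟩ ≤ J v for all v}`. -/
def subdifferential (J : X → ℝ≥0∞) (u : X) : Set (StrongDual ℝ X) :=
  {p | ∀ v : X, (J u : EReal) + ((p (v - u) : ℝ) : EReal) ≤ (J v : EReal)}

/-- The source elements: all `q` such that `A* q ∈ ∂J(u)` for some `u ∈ dom J` with `A u = f`.
This set is nonempty iff some `u` fulfils both the range condition and the source condition. -/
def sourceElements (A : X →L[ℝ] H) (J : X → ℝ≥0∞) (f : H) : Set H :=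
  {q | ∃ u ∈ effDomain J, A u = f ∧ adj A q ∈ subdifferential J u}

/-- The minimal norm of a source element. -/
noncomputable def sStar (A : X →L[ℝ] H) (J : X → ℝ≥0∞) (f : H) : ℝ :=
  sInf (norm '' sourceElements A J f)

open scoped Classical in
/-- The first critical time: `1 / s_*` if range and source condition hold, and `0` otherwise. -/
noncomputable def tStar (A : X →L[ℝ] H) (J : X → ℝ≥0∞) (f : H) : ℝ :=
  if (sourceElements A J f).Nonempty then 1 / sStar A J f else 0

/-- `sup {⟪f, A u⟫ | u ∈ N(J)^{⊥,A}, J u = 1}` (equal to `0` if there is no such `u`). -/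
noncomputable def supS (A : X →L[ℝ] H) (J : X → ℝ≥0∞) (f : H) : ℝ :=
  sSup {r | ∃ u ∈ aOrth A (nullSpace J), J u = 1 ∧ r = inner ℝ f (A u)}

open scoped Classical in
/-- The second critical time (extinction time). -/
noncomputable def tStarStar (A : X →L[ℝ] H) (J : X → ℝ≥0∞) (f : H) : ℝ :=
  if f = A (aProj A J f) then 0 else supS A J f / ‖f - A (aProj A J f)‖

end Functional

section JumpPart

variable {α E : Type*} [MeasurableSpace α] [NormedAddCommGroup E]

/-- The set of atoms (points of nonzero mass) of a vector measure. -/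
def atoms (μ : VectorMeasure α E) : Set α := {t | μ {t} ≠ 0}

/-- A vector measure has at most countably many atoms. -/
theorem countable_atoms [MeasurableSingletonClass α] (μ : VectorMeasure α E) :
    (atoms μ).Countable := by
  have key : ∀ n : ℕ, {t | 1 / ((n : ℝ) + 1) ≤ ‖μ {t}‖}.Finite := by
    intro n
    by_contra hinf
    have hinf : {t | 1 / ((n : ℝ) + 1) ≤ ‖μ {t}‖}.Infinite := hinf
    have hsum : HasSum (fun k : ℕ => μ {(hinf.natEmbedding _ k : α)})
        (μ (⋃ k : ℕ, {(hinf.natEmbedding _ k : α)})) := by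
      refine μ.m_iUnion (fun k => measurableSet_singleton _) ?_
      intro i j hij
      simp only [Function.onFun, Set.disjoint_singleton]
      exact fun h => hij ((hinf.natEmbedding _).injective (Subtype.ext h))
    have h0 := hsum.summable.tendsto_atTop_zero.norm
    rw [norm_zero] at h0
    have hpos : (0 : ℝ) < 1 / ((n : ℝ) + 1) := by positivity
    obtain ⟨k, hk⟩ := (h0.eventually (gt_mem_nhds hpos)).exists
    exact absurd (hinf.natEmbedding _ k).2 (not_le.mpr hk)
  refine (Set.countable_iUnion fun n => (key n).countable).mono ?_
  intro t ht
  obtain ⟨n, hn⟩ := exists_nat_one_div_lt (norm_pos_iff.mpr ht)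
  exact Set.mem_iUnion.mpr ⟨n, hn.le⟩

/-- The jump part of a vector measure: its restriction to the (countable, hence measurable) set of
its atoms, i.e. the sum of the point masses `μ {t} δ_t`. -/
noncomputable def jumpPart (μ : VectorMeasure α E) : VectorMeasure α E :=
  μ.restrict (atoms μ)

end JumpPart

/-- Compact segments of an open half-line are compact; needed to speak about the derivative
measure of a function of bounded variation on `(a, ∞)`. -/
instance instCompactIccSpaceIoi (a : ℝ) : CompactIccSpace (Ioi a) where
  isCompact_Icc := by
    intro x y
    rw [Subtype.isCompact_iff]
    have h : ((↑) : Ioi a → ℝ) '' Icc x y = Icc (x : ℝ) y := by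
      ext z
      constructor
      · rintro ⟨w, hw, rfl⟩
        exact hw
      · intro hz
        exact ⟨⟨z, lt_of_lt_of_le x.2 hz.1⟩, hz, rfl⟩
    rw [h]
    exact isCompact_Icc

end OneHomReg

/-! A minimizer `u` of `E_t` satisfies the variational inequality `⟪f - A u, A v - A u⟫ ≤ t ‖A u -
f‖ (J v - J u)`, as if it minimized `½‖A u - f‖² + τ J u` with the effective parameter `τ = t ‖A u -
f‖`. Combining it at two times so that the `J` terms cancel, and using Cauchy–Schwarz, gives `t ‖A
u_t - A u_s‖ ≤ τ(t) - τ(s)` for `s < t` (`IsMinimizer.mul_norm_sub_le`). So the variation of the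
path is controlled by a monotone function, with a factor that degenerates only as `t → 0`.

The path is explicit at both ends: exact penalization gives `A u_t = f` below `tStar`, and a duality
estimate gives `A u_t = A (aProj A J f)` beyond `tStarStar`. This bounds the variation near `∞`, and
near `0` if `tStar > 0`, and it excludes atoms outside `[tStar, tStarStar]`.

Existence is the direct method. `J (u_t)` is nonincreasing in `t`, hence continuous off a countable
set; where it is continuous, all minimizers share the value of `J` and therefore the image under
`A`. -/

namespace OneHomReg

/-! ### Optimality conditions and comparison of minimizers -/

section Minimizers

variable {X H : Type*} [NormedAddCommGroup X] [NormedSpace ℝ X]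
  [NormedAddCommGroup H] [InnerProductSpace ℝ H]
  {A : X →L[ℝ] H} {J : X → ℝ≥0∞} {f : H} {s t : ℝ} {u v : X}

theorem AbsOneHomogeneous.map_zero (hJ : AbsOneHomogeneous J) : J 0 = 0 := by
  simpa using hJ 0 0

theorem AbsOneHomogeneous.map_neg (hJ : AbsOneHomogeneous J) (u : X) : J (-u) = J u := by
  simpa using hJ (-1) u

/-- Midpoint convexity at `2 • x` and `2 • y`, with homogeneity absorbing the factors `2`. -/
theorem AbsOneHomogeneous.add_le (hJ : AbsOneHomogeneous J) (hc : ConvexOn ℝ≥0 univ J)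
    (x y : X) : J (x + y) ≤ J x + J y := by
  have h2 : (2⁻¹ : ℝ≥0) + 2⁻¹ = 1 := by
    rw [← two_mul]; exact mul_inv_cancel₀ two_ne_zero
  have h := hc.2 (mem_univ ((2 : ℝ) • x)) (mem_univ ((2 : ℝ) • y))
    (bot_le : (0 : ℝ≥0) ≤ 2⁻¹) (bot_le : (0 : ℝ≥0) ≤ 2⁻¹) h2
  have e : ∀ z : X, (2⁻¹ : ℝ≥0) • ((2 : ℝ) • z) = z := by
    intro z
    rw [NNReal.smul_def, smul_smul]
    simp
  have e' : ∀ z : X, (2⁻¹ : ℝ≥0) • J ((2 : ℝ) • z) = J z := by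
    intro z
    have := hJ (2⁻¹) ((2 : ℝ) • z)
    rw [smul_smul] at this
    norm_num at this
    rw [this, ENNReal.smul_def, smul_eq_mul]
    congr 1
    rw [ENNReal.ofReal]
    congr 1
    rw [← NNReal.coe_inj]
    norm_num
  rwa [e, e, e', e'] at h

theorem energy_of_ne_top (ht : 0 ≤ t) (hu : J u ≠ ⊤) :
    energy A J f t u = ENNReal.ofReal (‖A u - f‖ + t * (J u).toReal) := by
  rw [energy, ENNReal.ofReal_add (norm_nonneg _) (by positivity), ENNReal.ofReal_mul ht,
    ENNReal.ofReal_toReal hu]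

theorem IsMinimizer.ne_top (hJ : AbsOneHomogeneous J) (ht : 0 < t)
    (hu : IsMinimizer A J f t u) : J u ≠ ⊤ := by
  intro h
  have h0 := hu 0
  rw [energy_of_ne_top ht.le (by simp [hJ.map_zero] : J (0 : X) ≠ ⊤), energy, h,
    ENNReal.mul_top (by simpa using ht), add_top] at h0
  exact ENNReal.ofReal_ne_top (top_le_iff.mp h0)

theorem IsMinimizer.le_of_ne_top (hJ : AbsOneHomogeneous J) (ht : 0 < t)
    (hu : IsMinimizer A J f t u) (hv : J v ≠ ⊤) :
    ‖A u - f‖ + t * (J u).toReal ≤ ‖A v - f‖ + t * (J v).toReal := by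
  have h := hu v
  rw [energy_of_ne_top ht.le (hu.ne_top hJ ht), energy_of_ne_top ht.le hv] at h
  exact (ENNReal.ofReal_le_ofReal_iff (by positivity)).mp h

theorem AbsOneHomogeneous.smul_add_smul_le (hJ : AbsOneHomogeneous J)
    (hc : ConvexOn ℝ≥0 univ J) (hu : J u ≠ ⊤) (hv : J v ≠ ⊤) {a b : ℝ} (ha : 0 ≤ a)
    (hb : 0 ≤ b) :
    J (a • u + b • v) ≠ ⊤ ∧
      (J (a • u + b • v)).toReal ≤ a * (J u).toReal + b * (J v).toReal := by
  have h := hJ.add_le hc (a • u) (b • v)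
  rw [hJ, hJ, abs_of_nonneg ha, abs_of_nonneg hb] at h
  have h1 : ENNReal.ofReal a * J u ≠ ⊤ := ENNReal.mul_ne_top ENNReal.ofReal_ne_top hu
  have h2 : ENNReal.ofReal b * J v ≠ ⊤ := ENNReal.mul_ne_top ENNReal.ofReal_ne_top hv
  refine ⟨ne_top_of_le_ne_top (ENNReal.add_ne_top.mpr ⟨h1, h2⟩) h, ?_⟩
  have := ENNReal.toReal_mono (ENNReal.add_ne_top.mpr ⟨h1, h2⟩) h
  rwa [ENNReal.toReal_add h1 h2, ENNReal.toReal_mul, ENNReal.toReal_mul,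
    ENNReal.toReal_ofReal ha, ENNReal.toReal_ofReal hb] at this

/-- The variational inequality satisfied by minimizers. -/
theorem IsMinimizer.inner_le (hJ : AbsOneHomogeneous J) (hc : ConvexOn ℝ≥0 univ J)
    (ht : 0 < t) (hu : IsMinimizer A J f t u) (hv : J v ≠ ⊤) :
    inner ℝ (f - A u) (A v - A u) ≤ t * ‖A u - f‖ * ((J v).toReal - (J u).toReal) := by
  have hu' := hu.ne_top hJ ht
  -- Minimality is tested on the segment from `u` to `v`. Multiplying by `R` and using `2 R N ≤ R² +
  -- N²` replaces differentiation of the norm, so the case `R = 0` needs no separate treatment.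
  have key : ∀ l : ℝ, 0 < l → l ≤ 1 →
      inner ℝ (f - A u) (A v - A u) ≤ t * ‖A u - f‖ * ((J v).toReal - (J u).toReal)
        + l * (‖A v - A u‖ ^ 2 / 2) := by
    intro l hl hl1
    obtain ⟨h1, h2⟩ := hJ.smul_add_smul_le hc hu' hv (sub_nonneg.mpr hl1) hl.le
    have h3 := hu.le_of_ne_top hJ ht h1
    have e : A ((1 - l) • u + l • v) - f = (A u - f) + l • (A v - A u) := by
      simp only [map_add, map_smul]
      module
    have h4 : ‖(A u - f) + l • (A v - A u)‖ ^ 2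
        = ‖A u - f‖ ^ 2 + 2 * (l * inner ℝ (A u - f) (A v - A u)) + l ^ 2 * ‖A v - A u‖ ^ 2 := by
      rw [norm_add_sq_real, inner_smul_right, norm_smul, mul_pow, Real.norm_eq_abs, sq_abs]
    have h5 : inner ℝ (f - A u) (A v - A u) = - inner ℝ (A u - f) (A v - A u) := by
      rw [← inner_neg_left, neg_sub]
    rw [e] at h3
    rw [h5]
    set N := ‖(A u - f) + l • (A v - A u)‖
    set R := ‖A u - f‖
    set D := ‖A v - A u‖
    have hR : 0 ≤ R := norm_nonneg _
    have h6 : R ≤ N + t * (l * ((J v).toReal - (J u).toReal)) := by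
      nlinarith [mul_le_mul_of_nonneg_left h2 ht.le]
    have h7 := mul_le_mul_of_nonneg_left h6 hR
    have h8 := sq_nonneg (R - N)
    refine le_of_mul_le_mul_left ?_ hl
    nlinarith
  refine le_of_forall_pos_le_add fun ε hε => ?_
  set K := ‖A v - A u‖ ^ 2 / 2
  have hK : 0 ≤ K := by positivity
  have hl : 0 < min 1 (ε / (K + 1)) := by positivity
  refine (key _ hl (min_le_left _ _)).trans (add_le_add_right ?_ _)
  calc min 1 (ε / (K + 1)) * K ≤ ε / (K + 1) * (K + 1) := by
        gcongr
        · exact min_le_right _ _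
        · linarith
    _ = ε := by field_simp

/-- Adding the two minimality inequalities cancels the residuals. -/
theorem IsMinimizer.toReal_le_toReal (hJ : AbsOneHomogeneous J) (hs : 0 < s) (hst : s < t)
    (hu : IsMinimizer A J f s u) (hv : IsMinimizer A J f t v) :
    (J v).toReal ≤ (J u).toReal := by
  have h1 := hu.le_of_ne_top hJ hs (hv.ne_top hJ (hs.trans hst))
  have h2 := hv.le_of_ne_top hJ (hs.trans hst) (hu.ne_top hJ hs)
  have h3 : (t - s) * (J v).toReal ≤ (t - s) * (J u).toReal := by linarith
  exact le_of_mul_le_mul_left h3 (sub_pos.mpr hst)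

theorem IsMinimizer.norm_sub_le_norm_sub (hJ : AbsOneHomogeneous J) (hs : 0 < s) (hst : s < t)
    (hu : IsMinimizer A J f s u) (hv : IsMinimizer A J f t v) :
    ‖A u - f‖ ≤ ‖A v - f‖ := by
  have h1 := hu.le_of_ne_top hJ hs (hv.ne_top hJ (hs.trans hst))
  have h2 := mul_le_mul_of_nonneg_left (hu.toReal_le_toReal hJ hs hst hv) hs.le
  linarith

/-- The increments of the forward solution path are controlled by those of the monotone function
`t ↦ t ‖A u_t - f‖`. -/
theorem IsMinimizer.mul_norm_sub_le (hJ : AbsOneHomogeneous J) (hc : ConvexOn ℝ≥0 univ J)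
    (hs : 0 < s) (hst : s < t) (hu : IsMinimizer A J f s u) (hv : IsMinimizer A J f t v) :
    t * ‖A v - A u‖ ≤ t * ‖A v - f‖ - s * ‖A u - f‖ := by
  have ht := hs.trans hst
  have h1 := hu.inner_le hJ hc hs (hv.ne_top hJ ht)
  have h2 := hv.inner_le hJ hc ht (hu.ne_top hJ hs)
  have hR := hu.norm_sub_le_norm_sub hJ hs hst hv
  have e1 : inner ℝ (f - A u) (A v - A u)
      = inner ℝ (f - A v) (A v - A u) + ‖A v - A u‖ ^ 2 := by
    rw [← real_inner_self_eq_norm_sq, ← inner_add_left]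
    congr 1
    abel
  have e2 : inner ℝ (f - A v) (A u - A v) = - inner ℝ (f - A v) (A v - A u) := by
    rw [← inner_neg_right, neg_sub]
  have hcs := (abs_le.mp (abs_real_inner_le_norm (f - A v) (A v - A u))).1
  rw [norm_sub_rev f] at hcs
  rw [e1] at h1
  rw [e2] at h2
  set I := inner ℝ (f - A v) (A v - A u)
  set D := ‖A v - A u‖ with hD
  set Rs := ‖A u - f‖ with hRs
  set Rt := ‖A v - f‖ with hRt
  have hRs0 : 0 ≤ Rs := norm_nonneg _
  have hD0 : 0 ≤ D := norm_nonneg _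
  -- If the later residual vanishes, so does the earlier one, and both images equal `f`; otherwise
  -- division by `Rt` is allowed.
  rcases (norm_nonneg _ : 0 ≤ Rt).eq_or_lt with h0 | h0
  · have hu0 : Rs = 0 := le_antisymm (hR.trans h0.ge) hRs0
    have e : A v - A u = 0 := by
      rw [sub_eq_zero.mp (norm_eq_zero.mp h0.symm), sub_eq_zero.mp (norm_eq_zero.mp hu0), sub_self]
    rw [hD, e, hu0, ← h0.trans hRt.symm]
    simp
  · have hτ : s * Rs ≤ t * Rt := mul_le_mul hst.le hR hRs0 ht.le
    -- The weights `t * Rt` and `s * Rs` make the `J` terms cancel in the sum `h5`.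
    have h3 := mul_le_mul_of_nonneg_left h1 (by positivity : 0 ≤ t * Rt)
    have h4 := mul_le_mul_of_nonneg_left h2 (by positivity : 0 ≤ s * Rs)
    have h5 : (t * Rt - s * Rs) * I + t * Rt * D ^ 2 ≤ 0 := by linarith
    have h6 := mul_le_mul_of_nonneg_left hcs (sub_nonneg.mpr hτ)
    have h7 : (Rt * D) * (t * D) ≤ (Rt * D) * (t * Rt - s * Rs) := by linarith
    rcases hD0.eq_or_lt with h8 | h8
    · rw [← h8, mul_zero]
      linarith
    · exact le_of_mul_le_mul_left h7 (by positivity)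

/-- Two minimizers with the same regularization value have the same image. -/
theorem IsMinimizer.map_eq_of_toReal_eq (hJ : AbsOneHomogeneous J) (hc : ConvexOn ℝ≥0 univ J)
    (ht : 0 < t) (hu : IsMinimizer A J f t u) (hv : IsMinimizer A J f t v)
    (h : (J u).toReal = (J v).toReal) : A u = A v := by
  have hu' := hu.ne_top hJ ht
  have hv' := hv.ne_top hJ ht
  have h1 := hu.inner_le hJ hc ht hv'
  have h2 := hv.inner_le hJ hc ht hu'
  rw [h, sub_self, mul_zero] at h1 h2
  have e : ‖A v - A u‖ ^ 2
      = inner ℝ (f - A u) (A v - A u) + inner ℝ (f - A v) (A u - A v) := by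
    rw [← neg_sub (A v) (A u), inner_neg_right, ← sub_eq_add_neg, ← inner_sub_left,
      ← real_inner_self_eq_norm_sq]
    congr 1
    abel
  have h3 : ‖A v - A u‖ ^ 2 ≤ 0 := by linarith
  have h4 : A v - A u = 0 := by
    rw [← norm_eq_zero]
    exact pow_eq_zero_iff two_ne_zero |>.mp (le_antisymm h3 (sq_nonneg _))
  exact (sub_eq_zero.mp h4).symm

/-- Below the first critical time the data are reproduced exactly. -/
theorem IsMinimizer.map_eq_of_lt_tStar (hJ : AbsOneHomogeneous J)
    (ht : 0 < t) (hts : t < tStar A J f) (hu : IsMinimizer A J f t u) : A u = f := by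
  unfold tStar at hts
  split_ifs at hts with hne
  · have hs : 0 < sStar A J f := by
      by_contra hs
      exact absurd (ht.trans hts) (not_lt.mpr (one_div_nonpos.mpr (not_lt.mp hs)))
    have h1 : sStar A J f < 1 / t := by
      rw [lt_one_div hs ht]
      exact hts
    obtain ⟨_, ⟨q, ⟨w, hw, hwf, hq⟩, rfl⟩, hqt⟩ :=
      exists_lt_of_csInf_lt (hne.image norm) h1
    rw [lt_div_iff₀ ht] at hqt
    have hw' : J w ≠ ⊤ := ne_of_lt hw
    have hu' := hu.ne_top hJ ht
    have h2 := hq u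
    have h3 := hu.le_of_ne_top hJ ht hw'
    lift J w to ℝ≥0 using hw' with a
    lift J u to ℝ≥0 using hu' with b
    have h4 : (a : ℝ) + inner ℝ q (A u - f) ≤ b := by
      have e : (adj A q) (u - w) = inner ℝ q (A u - f) := by
        simp [adj, hwf]
      rw [e, EReal.coe_nnreal_eq_coe_real, EReal.coe_nnreal_eq_coe_real] at h2
      exact_mod_cast h2
    simp only [ENNReal.coe_toReal, hwf, sub_self, norm_zero, zero_add] at h3
    have hcs := (abs_le.mp (abs_real_inner_le_norm q (A u - f))).1
    -- Exact penalization: `‖A u - f‖ ≤ t (J w - J u) ≤ t ‖q‖ ‖A u - f‖`, where `t ‖q‖ < 1`.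
    have h5 : (1 - ‖q‖ * t) * ‖A u - f‖ ≤ 0 := by
      nlinarith [mul_le_mul_of_nonneg_left hcs ht.le, mul_le_mul_of_nonneg_left h4 ht.le]
    have h6 : ‖A u - f‖ ≤ 0 := by
      by_contra h6
      exact absurd h5 (not_le.mpr (mul_pos (by linarith) (not_le.mp h6)))
    exact sub_eq_zero.mp (norm_le_zero_iff.mp h6)
  · exact absurd ht hts.not_gt

end Minimizers

/-! ### Bounded variation and atoms -/

section Variation

/-- A function whose increments are controlled by those of a bounded monotone function has bounded
variation. -/
theorem boundedVariationOn_of_dist_le {E : Type*} [PseudoMetricSpace E] {φ : ℝ → E} {g : ℝ → ℝ}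
    {s : Set ℝ} {m M : ℝ} (hm : ∀ x ∈ s, m ≤ g x) (hM : ∀ x ∈ s, g x ≤ M)
    (h : ∀ x ∈ s, ∀ y ∈ s, x < y → dist (φ x) (φ y) ≤ g y - g x) : BoundedVariationOn φ s := by
  have hle : eVariationOn φ s ≤ ENNReal.ofReal (M - m) := by
    refine iSup_le ?_
    rintro ⟨n, w, hw, hws⟩
    have h1 : ∀ i, edist (φ (w (i + 1))) (φ (w i)) ≤ ENNReal.ofReal (g (w (i + 1)) - g (w i)) ∧
        0 ≤ g (w (i + 1)) - g (w i) := by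
      intro i
      rcases (hw i.le_succ).eq_or_lt with e | e
      · rw [← e]
        simp
      · have h2 := h _ (hws i) _ (hws (i + 1)) e
        refine ⟨?_, dist_nonneg.trans h2⟩
        rw [edist_dist, dist_comm]
        exact ENNReal.ofReal_le_ofReal h2
    calc ∑ i ∈ Finset.range n, edist (φ (w (i + 1))) (φ (w i))
        ≤ ∑ i ∈ Finset.range n, ENNReal.ofReal (g (w (i + 1)) - g (w i)) :=
          Finset.sum_le_sum fun i _ => (h1 i).1
      _ = ENNReal.ofReal (∑ i ∈ Finset.range n, (g (w (i + 1)) - g (w i))) :=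
          (ENNReal.ofReal_sum_of_nonneg fun i _ => (h1 i).2).symm
      _ ≤ ENNReal.ofReal (M - m) := by
          rw [Finset.sum_range_sub (fun i => g (w i))]
          exact ENNReal.ofReal_le_ofReal (sub_le_sub (hM _ (hws n)) (hm _ (hws 0)))
  exact ne_top_of_le_ne_top ENNReal.ofReal_ne_top hle

/-- The mass of a point is the difference of the one-sided limits, which vanishes where `φ` is
locally constant; so `s` contains no atom. -/
theorem jumpPart_eq_zero_of_eventuallyEq {E : Type*} [NormedAddCommGroup E] [NormedSpace ℝ E]
    [CompleteSpace E] {a : ℝ} {φ : Ioi a → E} (hφ : BoundedVariationOn φ univ) {s : Set (Ioi a)}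
    (hs : MeasurableSet s) (h : ∀ t ∈ s, ∀ᶠ x in 𝓝 t, φ x = φ t) :
    jumpPart hφ.vectorMeasure s = 0 := by
  rw [jumpPart, VectorMeasure.restrict_apply _ (countable_atoms _).measurableSet hs]
  have he : s ∩ atoms hφ.vectorMeasure = ∅ := by
    refine eq_empty_of_forall_notMem ?_
    rintro t ⟨hts, hta⟩
    refine hta ?_
    have hc : ContinuousAt φ t :=
      (continuousAt_const (y := φ t)).congr ((h t hts).mono fun x hx => hx.symm)
    rw [hφ.vectorMeasure_singleton, hc.continuousWithinAt.rightLim_eq, hc.continuousWithinAt.leftLim_eq, sub_self]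
  rw [he, VectorMeasure.empty]

end Variation

/-! ### Projection onto the null-space and the extinction time -/

section Projection

variable {X H : Type*} [NormedAddCommGroup X] [NormedSpace ℝ X]
  [NormedAddCommGroup H] [InnerProductSpace ℝ H]
  {A : X →L[ℝ] H} {J : X → ℝ≥0∞} {f g : H} {t : ℝ} {u v w : X}

/-- The null-space of `J` as a submodule. -/
def nullSubmodule (hJ : AbsOneHomogeneous J) (hc : ConvexOn ℝ≥0 univ J) : Submodule ℝ X where
  carrier := nullSpace J
  zero_mem' := hJ.map_zero
  add_mem' {x y} hx hy := by
    have h := hJ.add_le hc x y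
    rw [show J x = 0 from hx, show J y = 0 from hy, add_zero] at h
    exact nonpos_iff_eq_zero.mp h
  smul_mem' c x hx := by
    change J (c • x) = 0
    rw [hJ, show J x = 0 from hx, mul_zero]

theorem map_sub_of_mem_nullSpace (hJ : AbsOneHomogeneous J) (hc : ConvexOn ℝ≥0 univ J)
    (hw : w ∈ nullSpace J) : J (u - w) = J u := by
  have h0 : J w = 0 := hw
  refine le_antisymm ?_ ?_
  · have h := hJ.add_le hc u (-w)
    rwa [hJ.map_neg, h0, add_zero, ← sub_eq_add_neg] at h
  · have h := hJ.add_le hc (u - w) w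
    rwa [h0, add_zero, sub_add_cancel] at h

/-- The null-space is closed by lower semicontinuity, and `A` is bounded below on it, so its image
is complete and the Hilbert projection theorem applies there. -/
theorem exists_isAProj [CompleteSpace X] (hJ : AbsOneHomogeneous J) (hc : ConvexOn ℝ≥0 univ J)
    (hlsc : LowerSemicontinuous J) {c : ℝ} (hc0 : 0 < c)
    (hA : ∀ u ∈ nullSpace J, c * ‖u‖ ≤ ‖A u‖) (g : H) : ∃ w, IsAProj A J g w := by
  set N := nullSubmodule hJ hc
  have hcl : IsClosed (N : Set X) := by
    have h := hlsc.isClosed_preimage 0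
    convert h using 1
    ext x
    exact nonpos_iff_eq_zero.symm
  have : CompleteSpace N := hcl.completeSpace_coe
  let B : N →L[ℝ] H := A.comp N.subtypeL
  have hB : AntilipschitzWith (Real.toNNReal c⁻¹) B := by
    refine ContinuousLinearMap.antilipschitz_of_bound B fun x => ?_
    rw [Real.coe_toNNReal _ (by positivity), inv_mul_eq_div, le_div_iff₀ hc0, mul_comm]
    exact hA x x.2
  have hcomp : IsComplete ((LinearMap.range B.toLinearMap : Submodule ℝ H) : Set H) := by
    have h := hB.isComplete_range B.uniformContinuous
    have e : ((LinearMap.range B.toLinearMap : Submodule ℝ H) : Set H) = range B := rfl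
    rw [e]
    exact h
  obtain ⟨_, ⟨w, rfl⟩, hw⟩ := Submodule.exists_norm_eq_iInf_of_complete_subspace _ hcomp g
  refine ⟨w, w.2, fun v hv => ?_⟩
  rw [norm_sub_rev, norm_sub_rev (A v)]
  refine hw.le.trans ?_
  exact ciInf_le ⟨0, by rintro _ ⟨z, rfl⟩; exact norm_nonneg _⟩
    (⟨B ⟨v, hv⟩, ⟨⟨v, hv⟩, rfl⟩⟩ : (LinearMap.range B.toLinearMap : Submodule ℝ H))

theorem IsAProj.inner_eq_zero (hJ : AbsOneHomogeneous J) (hc : ConvexOn ℝ≥0 univ J)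
    (hw : IsAProj A J g w) (hv : v ∈ nullSpace J) : inner ℝ (g - A w) (A v) = 0 := by
  set K := (nullSubmodule hJ hc).map A.toLinearMap
  have hwK : A w ∈ K := ⟨w, hw.1, rfl⟩
  refine (Submodule.norm_eq_iInf_iff_real_inner_eq_zero K hwK).mp ?_ _ ⟨v, hv, rfl⟩
  refine le_antisymm (le_ciInf ?_) ?_
  · rintro ⟨_, z, hz, rfl⟩
    rw [norm_sub_rev, norm_sub_rev g]
    exact hw.2 z hz
  · exact ciInf_le ⟨0, by rintro _ ⟨z, rfl⟩; exact norm_nonneg _⟩ (⟨A w, hwK⟩ : K)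

theorem IsAProj.norm_map_le (hJ : AbsOneHomogeneous J) (hw : IsAProj A J g w) :
    ‖A w‖ ≤ 2 * ‖g‖ := by
  have h := hw.2 0 hJ.map_zero
  rw [map_zero, zero_sub, norm_neg] at h
  have h2 := norm_add_le (A w - g) g
  rw [sub_add_cancel] at h2
  linarith

theorem sub_aProj_mem_aOrth (hJ : AbsOneHomogeneous J) (hc : ConvexOn ℝ≥0 univ J)
    (hw : IsAProj A J (A u) w) : u - w ∈ aOrth A (nullSpace J) := fun v hv => by
  rw [map_sub]
  exact hw.inner_eq_zero hJ hc hv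

theorem eq_zero_of_mem_nullSpace_of_mem_aOrth {c : ℝ} (hc0 : 0 < c)
    (hA : ∀ u ∈ nullSpace J, c * ‖u‖ ≤ ‖A u‖) (hu : u ∈ nullSpace J)
    (hu' : u ∈ aOrth A (nullSpace J)) : u = 0 := by
  have h := hA u hu
  rw [norm_eq_zero.mpr (inner_self_eq_zero.mp (hu' u hu))] at h
  exact norm_le_zero_iff.mp (nonpos_of_mul_nonpos_right h hc0)

theorem aProj_eq_zero_of_mem_aOrth (hJ : AbsOneHomogeneous J) (hc : ConvexOn ℝ≥0 univ J)
    {c : ℝ} (hc0 : 0 < c) (hA : ∀ u ∈ nullSpace J, c * ‖u‖ ≤ ‖A u‖)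
    (hw : IsAProj A J (A u) w) (hu : u ∈ aOrth A (nullSpace J)) : w = 0 := by
  refine eq_zero_of_mem_nullSpace_of_mem_aOrth hc0 hA hw.1 fun v hv => ?_
  have h := hw.inner_eq_zero hJ hc hv
  rw [inner_sub_left, hu v hv] at h
  linarith

/-- Under the Poincaré inequality the extinction time is a finite supremum. -/
theorem bddAbove_supS (hJ : AbsOneHomogeneous J) (hc : ConvexOn ℝ≥0 univ J)
    {c : ℝ} (hc0 : 0 < c) (hA : ∀ u ∈ nullSpace J, c * ‖u‖ ≤ ‖A u‖)
    (hP : ∀ g, IsAProj A J g (aProj A J g)) {C : ℝ} (hC0 : 0 < C)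
    (hC : ∀ u, ENNReal.ofReal ‖u - aProj A J (A u)‖ ≤ ENNReal.ofReal C * J u) (f : H) :
    BddAbove {r | ∃ u ∈ aOrth A (nullSpace J), J u = 1 ∧ r = inner ℝ f (A u)} := by
  refine ⟨‖f‖ * (‖A‖ * C), ?_⟩
  rintro _ ⟨u, hu, hu1, rfl⟩
  have h := hC u
  rw [aProj_eq_zero_of_mem_aOrth hJ hc hc0 hA (hP _) hu, sub_zero, hu1, mul_one,
    ENNReal.ofReal_le_ofReal_iff hC0.le] at h
  calc inner ℝ f (A u) ≤ ‖f‖ * ‖A u‖ := real_inner_le_norm _ _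
    _ ≤ ‖f‖ * (‖A‖ * C) := by
      gcongr
      exact (A.le_opNorm u).trans (by gcongr)

/-- Homogeneity rescales `u` to `J u = 1`. -/
theorem inner_le_supS_mul (hJ : AbsOneHomogeneous J)
    (hb : BddAbove {r | ∃ u ∈ aOrth A (nullSpace J), J u = 1 ∧ r = inner ℝ f (A u)})
    (hu : u ∈ aOrth A (nullSpace J)) (h0 : J u ≠ 0) (h1 : J u ≠ ⊤) :
    inner ℝ f (A u) ≤ supS A J f * (J u).toReal := by
  have hpos : 0 < (J u).toReal := ENNReal.toReal_pos h0 h1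
  rw [← div_le_iff₀ hpos]
  refine le_csSup hb ⟨(J u).toReal⁻¹ • u, fun v hv => ?_, ?_, ?_⟩
  · rw [map_smul, inner_smul_left, hu v hv, mul_zero]
  · rw [hJ, abs_of_pos (inv_pos.mpr hpos), ENNReal.ofReal_inv_of_pos hpos,
      ENNReal.ofReal_toReal h1, ENNReal.inv_mul_cancel h0 h1]
  · rw [map_smul, inner_smul_right, inv_mul_eq_div]

/-- Beyond the second critical time the solution path is constant. -/
theorem IsMinimizer.map_eq_of_tStarStar_lt (hJ : AbsOneHomogeneous J)
    (hc : ConvexOn ℝ≥0 univ J) {c : ℝ} (hc0 : 0 < c)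
    (hA : ∀ u ∈ nullSpace J, c * ‖u‖ ≤ ‖A u‖)
    (hP : ∀ g, IsAProj A J g (aProj A J g)) {C : ℝ} (hC0 : 0 < C)
    (hC : ∀ u, ENNReal.ofReal ‖u - aProj A J (A u)‖ ≤ ENNReal.ofReal C * J u)
    (hf : f ≠ A (aProj A J f)) (ht : 0 < t) (htt : tStarStar A J f < t)
    (hu : IsMinimizer A J f t u) : A u = A (aProj A J f) := by
  rw [tStarStar, if_neg hf] at htt
  have hb := bddAbove_supS hJ hc hc0 hA hP hC0 hC f
  have hwf := hP f
  have hwu := hP (A u)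
  set w := aProj A J f
  set n := aProj A J (A u)
  have hr : 0 < ‖f - A w‖ := norm_pos_iff.mpr (sub_ne_zero.mpr hf)
  rw [div_lt_iff₀ hr] at htt
  have hu' := hu.ne_top hJ ht
  have hJw : J w = 0 := hwf.1
  have hmin := hu.le_of_ne_top hJ ht (v := w) (by simp [hJw])
  rw [hJw, ENNReal.toReal_zero, mul_zero, add_zero, norm_sub_rev (A w)] at hmin
  have hor : u - n ∈ aOrth A (nullSpace J) := sub_aProj_mem_aOrth hJ hc hwu
  have hJv : J (u - n) = J u := map_sub_of_mem_nullSpace hJ hc hwu.1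
  -- Write `r = ‖f - A w‖`. If `J u > 0`, then `r ‖f - A u‖ ≥ ⟪f - A w, f - A u⟫ ≥ r² - supS * J u >
  -- r² - r t J u`, which contradicts the comparison `hmin` with `w`.
  have hJ0 : J u = 0 := by
    by_contra h0
    have hpos : 0 < (J u).toReal := ENNReal.toReal_pos h0 hu'
    have h1 := inner_le_supS_mul (f := f) hJ hb hor (by rwa [hJv]) (by rwa [hJv])
    rw [hJv] at h1
    have h2 : inner ℝ (f - A w) (A u) = inner ℝ f (A (u - n)) := by
      have e1 := hwf.inner_eq_zero hJ hc hwu.1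
      have e2 := hor w hwf.1
      rw [real_inner_comm] at e2
      have e3 : A u = A (u - n) + A n := by rw [← map_add, sub_add_cancel]
      rw [e3, inner_add_right, e1, inner_sub_left, e2]
      ring
    have h3 : inner ℝ (f - A w) (f - A u) = ‖f - A w‖ ^ 2 - inner ℝ (f - A w) (A u) := by
      have e1 := hwf.inner_eq_zero hJ hc hwf.1
      have e2 := real_inner_self_eq_norm_sq (f - A w)
      rw [inner_sub_right, e1] at e2
      rw [inner_sub_right]
      linarith
    have h4 := real_inner_le_norm (f - A w) (f - A u)
    rw [h3, h2, norm_sub_rev f (A u)] at h4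
    have h5 := mul_lt_mul_of_pos_right htt hpos
    nlinarith [mul_le_mul_of_nonneg_left hmin hr.le]
  rw [hJ0, ENNReal.toReal_zero, mul_zero, add_zero, norm_sub_rev] at hmin
  have h1 := hwf.inner_eq_zero hJ hc (show u ∈ nullSpace J from hJ0)
  have h2 := hwf.inner_eq_zero hJ hc hwf.1
  -- Now `u` lies in the null-space and is at least as close to `f` as `w`; Pythagoras forces equal
  -- images.
  have h3 : ‖f - A u‖ ^ 2 = ‖f - A w‖ ^ 2 + ‖A w - A u‖ ^ 2 := by
    have e : f - A u = (f - A w) + (A w - A u) := by abel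
    rw [e, norm_add_sq_real, inner_sub_right, h1, h2]
    ring
  have h4 : ‖A w - A u‖ ^ 2 ≤ 0 := by
    nlinarith [norm_nonneg (f - A u)]
  have h5 := norm_eq_zero.mp (pow_eq_zero_iff two_ne_zero |>.mp (le_antisymm h4 (sq_nonneg _)))
  exact (sub_eq_zero.mp h5).symm

end Projection

/-! ### Existence of minimizers by the direct method -/

section Existence

variable {Y : Type*} [NormedAddCommGroup Y] [NormedSpace ℝ Y]
  {H : Type*} [NormedAddCommGroup H] [InnerProductSpace ℝ H]
  {A : StrongDual ℝ Y →L[ℝ] H} {J : StrongDual ℝ Y → ℝ≥0∞} {f : H} {t : ℝ}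

/-- Coercivity: the Poincaré inequality bounds `u - aProj A J (A u)` by `J u`, and norm equivalence
on the null-space bounds the projection by `‖A u‖`. -/
theorem exists_norm_le_of_energy_le (hJ : AbsOneHomogeneous J) {c : ℝ} (hc0 : 0 < c)
    (hA : ∀ u ∈ nullSpace J, c * ‖u‖ ≤ ‖A u‖)
    (hP : ∀ g, IsAProj A J g (aProj A J g)) {C : ℝ} (hC0 : 0 < C)
    (hC : ∀ u, ENNReal.ofReal ‖u - aProj A J (A u)‖ ≤ ENNReal.ofReal C * J u)
    (ht : 0 < t) {B : ℝ} (hB : 0 ≤ B) :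
    ∃ R : ℝ, ∀ u, energy A J f t u ≤ ENNReal.ofReal B → ‖u‖ ≤ R := by
  refine ⟨C * (B / t) + 2 * (B + ‖f‖) / c, fun u hu => ?_⟩
  have ht' : ENNReal.ofReal t ≠ 0 := by simpa using ht
  have hle : ENNReal.ofReal t * J u ≤ ENNReal.ofReal B := le_add_self.trans hu
  have hJu : J u ≠ ⊤ := by
    intro h
    rw [h, ENNReal.mul_top ht'] at hle
    exact ENNReal.ofReal_ne_top (top_le_iff.mp hle)
  rw [energy_of_ne_top ht.le hJu, ENNReal.ofReal_le_ofReal_iff hB] at hu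
  have h0 : 0 ≤ t * (J u).toReal := by positivity
  have h1 : (J u).toReal ≤ B / t := by
    rw [le_div_iff₀ ht, mul_comm]
    linarith [norm_nonneg (A u - f)]
  have h2 : ‖u - aProj A J (A u)‖ ≤ C * (J u).toReal := by
    have h := hC u
    rw [← ENNReal.ofReal_toReal hJu, ← ENNReal.ofReal_mul hC0.le] at h
    exact (ENNReal.ofReal_le_ofReal_iff (by positivity)).mp h
  have h3 := hA _ (hP (A u)).1
  have h4 := (hP (A u)).norm_map_le hJ
  have h5 : ‖A u‖ ≤ B + ‖f‖ := by
    have h := norm_add_le (A u - f) f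
    rw [sub_add_cancel] at h
    linarith
  have h6 : ‖aProj A J (A u)‖ ≤ 2 * (B + ‖f‖) / c := by
    rw [le_div_iff₀ hc0]
    linarith
  have h7 := norm_add_le (u - aProj A J (A u)) (aProj A J (A u))
  rw [sub_add_cancel] at h7
  have h8 := mul_le_mul_of_nonneg_left h1 hC0.le
  linarith

theorem ennreal_liminf_add_liminf_le (a b : ℕ → ℝ≥0∞) :
    liminf a atTop + liminf b atTop ≤ liminf (fun n => a n + b n) atTop := by
  simp only [liminf_eq_iSup_iInf_of_nat']
  rw [ENNReal.iSup_add_iSup_of_monotone]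
  · exact iSup_mono fun n => le_iInf fun i => add_le_add (iInf_le _ i) (iInf_le _ i)
  all_goals
    intro m n hmn
    refine le_iInf fun i => (iInf_le _ (i + (n - m))).trans_eq ?_
    rw [add_assoc, Nat.sub_add_cancel hmn]

/-- Sequential weak* lower semicontinuity of the energy. -/
theorem energy_le_liminf
    (hlsc : LowerSemicontinuous (fun u : WeakDual ℝ Y => J (WeakDual.toStrongDual u)))
    {x : ℕ → StrongDual ℝ Y} {x₀ : StrongDual ℝ Y}
    (hx : Tendsto (fun n => StrongDual.toWeakDual (x n)) atTop (𝓝 (StrongDual.toWeakDual x₀)))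
    (hAx : Tendsto (fun n => toWeakSpace ℝ H (A (x n))) atTop (𝓝 (toWeakSpace ℝ H (A x₀)))) :
    energy A J f t x₀ ≤ liminf (fun n => energy A J f t (x n)) atTop := by
  have h1 : ENNReal.ofReal t * J x₀ ≤ liminf (fun n => ENNReal.ofReal t * J (x n)) atTop := by
    have hl := (ENNReal.continuous_const_mul
      (ENNReal.ofReal_ne_top (r := t))).comp_lowerSemicontinuous hlsc
      (fun a b hab => mul_le_mul_right hab _)
    refine le_of_forall_lt fun y hy => ?_
    obtain ⟨z, hyz, hz⟩ := exists_between hy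
    refine hyz.trans_le (le_liminf_of_le (by isBoundedDefault) ?_)
    exact (hx.eventually (hl _ z hz)).mono fun n hn => le_of_lt hn
  have h2 : ENNReal.ofReal ‖A x₀ - f‖
      ≤ liminf (fun n => ENNReal.ofReal ‖A (x n) - f‖) atTop := by
    have hin : ∀ q : H, Tendsto (fun n => inner ℝ q (A (x n))) atTop (𝓝 (inner ℝ q (A x₀))) := by
      intro q
      exact ((WeakBilin.eval_continuous (topDualPairing ℝ H).flip (innerSL ℝ q)).tendsto _).comp hAx
    set d := A x₀ - f
    -- Testing weak convergence against `d / ‖d‖` recovers `‖d‖`; for `d = 0` the convention `0 / 0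
    -- = 0` keeps the limit correct.
    have h3 : Tendsto (fun n => (inner ℝ d (A (x n)) - inner ℝ d f) / ‖d‖) atTop (𝓝 ‖d‖) := by
      have h := ((hin d).sub_const (inner ℝ d f)).div_const ‖d‖
      rw [← inner_sub_right, real_inner_self_eq_norm_sq, sq, mul_self_div_self] at h
      exact h
    have h4 := (ENNReal.continuous_ofReal.tendsto _).comp h3
    rw [← h4.liminf_eq]
    refine liminf_le_liminf (Eventually.of_forall fun n => ENNReal.ofReal_le_ofReal ?_)
    beta_reduce
    rw [← inner_sub_right]
    exact div_le_of_le_mul₀ (norm_nonneg _) (norm_nonneg _)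
      ((real_inner_le_norm _ _).trans_eq (mul_comm _ _))
  exact (add_le_add h2 h1).trans (ennreal_liminf_add_liminf_le _ _)

theorem exists_isMinimizer [TopologicalSpace.SeparableSpace Y] [CompleteSpace Y]
    (hJ : AbsOneHomogeneous J) {c : ℝ} (hc0 : 0 < c)
    (hA : ∀ u ∈ nullSpace J, c * ‖u‖ ≤ ‖A u‖)
    (hP : ∀ g, IsAProj A J g (aProj A J g)) {C : ℝ} (hC0 : 0 < C)
    (hC : ∀ u, ENNReal.ofReal ‖u - aProj A J (A u)‖ ≤ ENNReal.ofReal C * J u)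
    (hlsc : LowerSemicontinuous (fun u : WeakDual ℝ Y => J (WeakDual.toStrongDual u)))
    (hA_cont : ∀ (x : ℕ → StrongDual ℝ Y) (x₀ : StrongDual ℝ Y),
      Tendsto (fun n => StrongDual.toWeakDual (x n)) atTop (𝓝 (StrongDual.toWeakDual x₀)) →
      Tendsto (fun n => toWeakSpace ℝ H (A (x n))) atTop (𝓝 (toWeakSpace ℝ H (A x₀))))
    (ht : 0 < t) : ∃ u, IsMinimizer A J f t u := by
  obtain ⟨e, -, he, hmem⟩ := exists_seq_tendsto_sInf (range_nonempty (energy A J f t))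
    (OrderBot.bddBelow _)
  choose x hx using hmem
  have he' : e = fun n => energy A J f t (x n) := funext fun n => (hx n).symm
  subst he'
  have h0 : sInf (range (energy A J f t)) < ENNReal.ofReal (‖f‖ + 1) := by
    refine (sInf_le (mem_range_self 0)).trans_lt ?_
    rw [energy, hJ.map_zero, mul_zero, add_zero, map_zero, zero_sub, norm_neg]
    exact (ENNReal.ofReal_lt_ofReal_iff (by positivity)).mpr (lt_add_one _)
  obtain ⟨R, hR⟩ := exists_norm_le_of_energy_le (f := f) hJ hc0 hA hP hC0 hC ht
    (by positivity : 0 ≤ ‖f‖ + 1)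
  have hfr : ∃ᶠ n in atTop, StrongDual.toWeakDual (x n) ∈
      (WeakDual.toStrongDual ⁻¹' Metric.closedBall (0 : StrongDual ℝ Y) R) :=
    ((he.eventually (gt_mem_nhds h0)).mono fun n hn => by
      simpa using hR _ hn.le).frequently
  -- Separability of the predual makes closed balls weak* sequentially compact.
  obtain ⟨x₀, -, φ, hφ, hlim⟩ :=
    (WeakDual.isSeqCompact_closedBall ℝ Y 0 R).subseq_of_frequently_in hfr
  refine ⟨WeakDual.toStrongDual x₀, fun v => ?_⟩
  have hle := energy_le_liminf (A := A) (f := f) (t := t) hlsc (x := x ∘ φ)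
    (x₀ := WeakDual.toStrongDual x₀) hlim (hA_cont _ _ hlim)
  have hlim' := (he.comp hφ.tendsto_atTop).liminf_eq
  exact hle.trans (hlim'.le.trans (sInf_le (mem_range_self v)))

end Existence

/-! ### Regularity along a choice of minimizers -/

section Path

variable {X H : Type*} [NormedAddCommGroup X] [NormedSpace ℝ X]
  [NormedAddCommGroup H] [InnerProductSpace ℝ H]
  {A : X →L[ℝ] H} {J : X → ℝ≥0∞} {f : H} {u : ℝ → X}

theorem countable_not_continuousWithinAt_toReal (hJ : AbsOneHomogeneous J)
    (hu : ∀ t, 0 < t → IsMinimizer A J f t (u t)) :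
    {t ∈ Ioi (0 : ℝ) | ¬ ContinuousWithinAt (fun t => (J (u t)).toReal) (Ioi 0) t}.Countable := by
  refine AntitoneOn.countable_not_continuousWithinAt fun s hs t ht hst => ?_
  rcases hst.eq_or_lt with rfl | h
  · exact le_rfl
  · exact (hu s hs).toReal_le_toReal hJ hs h (hu t ht)

/-- By monotonicity, `J v` for any minimizer at time `t` lies between the right and left limits of
`J (u ·)` at `t`. -/
theorem IsMinimizer.toReal_eq_of_continuousWithinAt (hJ : AbsOneHomogeneous J)
    (hu : ∀ t, 0 < t → IsMinimizer A J f t (u t)) {t : ℝ} (ht : 0 < t) {v : X}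
    (hv : IsMinimizer A J f t v)
    (hcont : ContinuousWithinAt (fun t => (J (u t)).toReal) (Ioi 0) t) :
    (J v).toReal = (J (u t)).toReal := by
  have hc : Tendsto (fun t => (J (u t)).toReal) (𝓝 t) (𝓝 (J (u t)).toReal) :=
    hcont.continuousAt (Ioi_mem_nhds ht)
  refine le_antisymm ?_ ?_
  · refine ge_of_tendsto (hc.mono_left (nhdsWithin_le_nhds (s := Iio t))) ?_
    filter_upwards [Ioo_mem_nhdsLT ht] with s hs
    exact (hu s hs.1).toReal_le_toReal hJ hs.1 hs.2 hv
  · refine le_of_tendsto (hc.mono_left (nhdsWithin_le_nhds (s := Ioi t))) ?_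
    filter_upwards [self_mem_nhdsWithin] with s hs
    exact hv.toReal_le_toReal hJ ht hs (hu s (ht.trans hs))

/-- If the path is constant from `T` on and `d ‖h_t - h_s‖ ≤ t ‖h_t - f‖ - s ‖h_s - f‖` for
`s < t`, then the path has bounded variation. -/
theorem boundedVariationOn_path {E : Type*} [NormedAddCommGroup E] {h : ℝ → E} {f : E} {S : Set ℝ} {d T : ℝ} (hd : 0 < d)
    (hS : ∀ x ∈ S, 0 ≤ x) (hT : T ∈ S) (hconst : ∀ x ∈ S, T < x → h x = h T)
    (hle : ∀ x ∈ S, ∀ y ∈ S, x < y → d * ‖h y - h x‖ ≤ y * ‖h y - f‖ - x * ‖h x - f‖) :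
    BoundedVariationOn h S := by
  have hmin : ∀ x ∈ S, min x T ∈ S ∧ h (min x T) = h x := by
    intro x hx
    rcases le_or_gt x T with hxT | hxT
    · rw [min_eq_left hxT]
      exact ⟨hx, rfl⟩
    · rw [min_eq_right hxT.le]
      exact ⟨hT, (hconst x hx hxT).symm⟩
  -- Freezing time at `T` makes the monotone control bounded above without changing the path.
  refine boundedVariationOn_of_dist_le (g := fun x => min x T * ‖h (min x T) - f‖ / d)
    (m := 0) (M := T * ‖h T - f‖ / d) (fun x hx => ?_) (fun x hx => ?_)
    (fun x hx y hy hxy => ?_)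
  · have := hS _ (hmin x hx).1
    positivity
  · gcongr ?_ / d
    rcases (min_le_right x T).eq_or_lt with e | e
    · rw [e]
    · have h1 := hle _ (hmin x hx).1 T hT e
      have h2 : 0 ≤ d * ‖h T - h (min x T)‖ := by positivity
      linarith
  · rw [← (hmin x hx).2, ← (hmin y hy).2, dist_comm, dist_eq_norm, ← sub_div, le_div_iff₀ hd,
      mul_comm]
    rcases (min_le_min_right T hxy.le).eq_or_lt with e | e
    · rw [e]
      simp
    · exact hle _ (hmin x hx).1 _ (hmin y hy).1 e

end Path

end OneHomReg

/-! ### Assembly of the main theorem -/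

theorem mainTheorem8
    {Y : Type*} [NormedAddCommGroup Y] [NormedSpace ℝ Y] [CompleteSpace Y]
    [TopologicalSpace.SeparableSpace Y]
    {H : Type*} [NormedAddCommGroup H] [InnerProductSpace ℝ H] [CompleteSpace H]
    (A : StrongDual ℝ Y →L[ℝ] H) (J : StrongDual ℝ Y → ℝ≥0∞)
    (hJ_hom : OneHomReg.AbsOneHomogeneous J)
    (hJ_conv : ConvexOn ℝ≥0 univ J)
    (hJ_proper : (OneHomReg.effDomain J).Nonempty)
    (hJ_lsc : LowerSemicontinuous (fun u : WeakDual ℝ Y => J (WeakDual.toStrongDual u)))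
    -- `‖A ·‖` is a norm on the null-space of `J`, equivalent to the norm of the space
    (hA_norm : ∃ c : ℝ, 0 < c ∧ ∃ C : ℝ, 0 < C ∧ ∀ u ∈ OneHomReg.nullSpace J,
      c * ‖u‖ ≤ ‖A u‖ ∧ ‖A u‖ ≤ C * ‖u‖)
    -- generalized Poincaré inequality
    (hA_poincare : ∃ C : ℝ, 0 < C ∧ ∀ u,
      ENNReal.ofReal ‖u - OneHomReg.aProj A J (A u)‖ ≤ ENNReal.ofReal C * J u)
    -- weak*-to-weak continuity of `A`
    (hA_cont : ∀ (x : ℕ → StrongDual ℝ Y) (x₀ : StrongDual ℝ Y),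
      Tendsto (fun n => StrongDual.toWeakDual (x n)) atTop (𝓝 (StrongDual.toWeakDual x₀)) →
      Tendsto (fun n => toWeakSpace ℝ H (A (x n))) atTop (𝓝 (toWeakSpace ℝ H (A x₀))))
    (f : H)
    (hf : ∀ u, A u = f → u ∉ OneHomReg.nullSpace J) :
    -- the forward solution path exists for all `t > 0` and is unique for almost all of them
    (∀ t : ℝ, 0 < t → (OneHomReg.forwardSolutions A J f t).Nonempty) ∧
    (∀ᵐ t ∂(volume.restrict (Ioi (0 : ℝ))), ∃! h : H, h ∈ OneHomReg.forwardSolutions A J f t) ∧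
    -- every choice of the path (with any value at `t = 0`) has the asserted properties
    ∀ u : ℝ → StrongDual ℝ Y, (∀ t : ℝ, 0 < t → OneHomReg.IsMinimizer A J f t (u t)) →
      (∀ δ : ℝ, 0 < δ → BoundedVariationOn (fun t : ℝ => A (u t)) (Ioi δ)) ∧
      (0 < OneHomReg.tStar A J f → BoundedVariationOn (fun t : ℝ => A (u t)) (Ici 0)) ∧
      -- the jump part of the derivative measure on `(a, ∞)`, for all `a > 0`, and also for `a = 0`
      -- if the first critical time is positive
      (∀ a : ℝ, 0 ≤ a → (0 < a ∨ 0 < OneHomReg.tStar A J f) →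
        ∃ hbv : BoundedVariationOn (fun t : Ioi a => A (u t)) univ,
          ∀ s : Set (Ioi a), MeasurableSet s →
            (∀ t ∈ s, (t : ℝ) ∉ Icc (OneHomReg.tStar A J f) (OneHomReg.tStarStar A J f)) →
            OneHomReg.jumpPart hbv.vectorMeasure s = 0) := by
  obtain ⟨c, hc0, _, _, hA'⟩ := hA_norm
  have hA : ∀ u ∈ OneHomReg.nullSpace J, c * ‖u‖ ≤ ‖A u‖ := fun u hu => (hA' u hu).1
  obtain ⟨C, hC0, hC⟩ := hA_poincare
  have hlsc : LowerSemicontinuous J :=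
    hJ_lsc.comp (NormedSpace.Dual.toWeakDual_continuous (𝕜 := ℝ) (E := Y))
  have hP : ∀ g, OneHomReg.IsAProj A J g (OneHomReg.aProj A J g) := fun g =>
    Classical.epsilon_spec (OneHomReg.exists_isAProj hJ_hom hJ_conv hlsc hc0 hA g)
  have hfP : f ≠ A (OneHomReg.aProj A J f) := fun h => hf _ h.symm (hP f).1
  have hex : ∀ t : ℝ, 0 < t → ∃ u, OneHomReg.IsMinimizer A J f t u := fun t ht =>
    OneHomReg.exists_isMinimizer hJ_hom hc0 hA hP hC0 hC hJ_lsc hA_cont ht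
  refine ⟨fun t ht => (hex t ht).imp' A fun u hu => ⟨u, hu, rfl⟩, ?_, fun u hu => ?_⟩
  · choose! u hu using hex
    rw [ae_restrict_iff' measurableSet_Ioi]
    have hcount := OneHomReg.countable_not_continuousWithinAt_toReal hJ_hom hu
    filter_upwards [compl_mem_ae_iff.mpr (hcount.measure_zero volume)] with t ht ht0
    have hcont : ContinuousWithinAt (fun t => (J (u t)).toReal) (Ioi 0) t := by
      by_contra h
      exact ht ⟨ht0, h⟩
    refine ⟨A (u t), ⟨u t, hu t ht0, rfl⟩, ?_⟩
    rintro _ ⟨v, hv, rfl⟩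
    exact hv.map_eq_of_toReal_eq hJ_hom hJ_conv ht0 (hu t ht0)
      (hv.toReal_eq_of_continuousWithinAt hJ_hom hu ht0 hcont)
  have hlate : ∀ t, 0 < t → OneHomReg.tStarStar A J f < t →
      A (u t) = A (OneHomReg.aProj A J f) := fun t ht htt =>
    (hu t ht).map_eq_of_tStarStar_lt hJ_hom hJ_conv hc0 hA hP hC0 hC hfP ht htt
  have hearly : ∀ t, 0 < t → t < OneHomReg.tStar A J f → A (u t) = f := fun t ht htt =>
    (hu t ht).map_eq_of_lt_tStar hJ_hom ht htt
  have hstep : ∀ x, 0 < x → ∀ y, x < y →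
      y * ‖A (u y) - A (u x)‖ ≤ y * ‖A (u y) - f‖ - x * ‖A (u x) - f‖ := fun x hx y hxy =>
    (hu x hx).mul_norm_sub_le hJ_hom hJ_conv hx hxy (hu y (hx.trans hxy))
  obtain ⟨T, hT0, hT⟩ : ∃ T : ℝ, 0 < T ∧ OneHomReg.tStarStar A J f < T :=
    ⟨max (OneHomReg.tStarStar A J f) 0 + 1,
      add_pos_of_nonneg_of_pos (le_max_right _ _) one_pos,
      (le_max_left _ _).trans_lt (lt_add_one _)⟩
  have hconst : ∀ S, T ≤ S → ∀ x, S < x → A (u x) = A (u S) := fun S hS x hx => by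
    rw [hlate x (hT0.trans (hS.trans_lt hx)) (hT.trans (hS.trans_lt hx)),
      hlate S (hT0.trans_le hS) (hT.trans_le hS)]
  have hδ : ∀ δ : ℝ, 0 < δ → BoundedVariationOn (fun t : ℝ => A (u t)) (Ioi δ) := by
    intro δ hδ
    -- The freezing time must itself lie in `Ioi δ`, hence the maximum.
    refine OneHomReg.boundedVariationOn_path (f := f) (T := max T (δ + 1)) hδ
      (fun x hx => (hδ.trans hx).le) ?_ (fun x _ hx => hconst _ (le_max_left _ _) x hx) ?_
    · exact (lt_add_one δ).trans_le (le_max_right _ _)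
    · intro x hx y hy hxy
      exact (mul_le_mul_of_nonneg_right (le_of_lt hy) (norm_nonneg _)).trans
        (hstep x (hδ.trans hx) y hxy)
  have h0 : 0 < OneHomReg.tStar A J f → BoundedVariationOn (fun t : ℝ => A (u t)) (Ici 0) := by
    intro hts
    have hpos : BoundedVariationOn (fun t : ℝ => A (u t)) (Ioi 0) := by
      -- The constant `tStar` serves down to `0`: increments vanish for `y < tStar`, and otherwise
      -- the factor `y` is at least `tStar`.
      refine OneHomReg.boundedVariationOn_path (f := f) (T := T) hts
        (fun x hx => le_of_lt hx) hT0 (fun x _ hx => hconst _ le_rfl x hx) ?_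
      intro x hx y hy hxy
      rcases lt_or_ge y (OneHomReg.tStar A J f) with hyt | hyt
      · rw [hearly x hx (hxy.trans hyt), hearly y hy hyt]
        simp
      · exact (mul_le_mul_of_nonneg_right hyt (norm_nonneg _)).trans (hstep x hx y hxy)
    have hlim : Tendsto (fun t : ℝ => A (u t)) (𝓝[univ ∩ Ioi 0] 0) (𝓝 f) := by
      rw [univ_inter]
      refine tendsto_const_nhds.congr' ?_
      filter_upwards [Ioo_mem_nhdsGT hts] with t ht
      exact (hearly t ht.1 ht.2).symm
    -- The arbitrary value at `0` adds only the finite distance to the right limit `f`.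
    have hvar := eVariationOn.eVariationOn_on_inter_Ici_eq_Ioi_add_edist
      (by rw [univ_inter]; infer_instance) (mem_univ _) hlim
    rw [univ_inter, univ_inter] at hvar
    rw [BoundedVariationOn, hvar]
    exact ENNReal.add_ne_top.mpr ⟨hpos, edist_ne_top _ _⟩
  refine ⟨hδ, h0, fun a ha hat => ?_⟩
  have hIoi : BoundedVariationOn (fun t : ℝ => A (u t)) (Ioi a) := by
    rcases hat with h | h
    · exact hδ a h
    · exact (h0 h).mono fun x hx => ha.trans (le_of_lt hx)
  have hbv : BoundedVariationOn (fun t : Ioi a => A (u t)) univ :=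
    ne_top_of_le_ne_top hIoi (eVariationOn.comp_le_of_monotoneOn (fun t : ℝ => A (u t))
      ((↑) : Ioi a → ℝ) (Subtype.mono_coe _ |>.monotoneOn _) fun x _ => x.2)
  refine ⟨hbv, fun s hs hst => ?_⟩
  refine OneHomReg.jumpPart_eq_zero_of_eventuallyEq hbv hs fun t ht => ?_
  have hpos : ∀ x : Ioi a, 0 < (x : ℝ) := fun x => ha.trans_lt x.2
  have hcoe : Tendsto ((↑) : Ioi a → ℝ) (𝓝 t) (𝓝 (t : ℝ)) := continuous_subtype_val.tendsto t
  rcases lt_or_ge (t : ℝ) (OneHomReg.tStar A J f) with h | h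
  · filter_upwards [hcoe.eventually (gt_mem_nhds h)] with x hx
    rw [hearly x (hpos x) hx, hearly t (hpos t) h]
  · have h' : OneHomReg.tStarStar A J f < t := not_le.mp fun h' => hst t ht ⟨h, h'⟩
    filter_upwards [hcoe.eventually (lt_mem_nhds h')] with x hx
    rw [hlate x (hpos x) hx, hlate t (hpos t) h']
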